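/- **Setting.** Let $X$ be a nonempty set, let $\xi_1,\xi_2,\dots$ be an i.i.d. sample with law $P$ on a measurable space $\Xi$, defined on a probability space $(\Omega,\mathcal F,\mathbb P)$, and let $h:X\times\Xi\to\mathbb R$ be such that each $h(x,\cdot)$ is measurable and $P$-integrable. Put $$f(x)=\int h(x,z)\,P(dz),\quad \hat f_n(x)=\frac1n\sum_{i=1}^n h(x,\xi_i),\quad \psi^*=\inf_{x\in X} f(x),\quad \hat\psi_n=\inf_{x\in X}\hat f_n(x),\quad S^\varepsilon=\{x\in X: f(x)\le\psi^*+\varepsilon\}.$$ Let $\ell^\infty(X)$ be the space of bounded real functions on $X$ with the supremum norm, and let $\iota:\ell^\infty(X)\to\mathbb R$, $\iota(g)=\inf_{x\in X} g(x)$. For a map $U:\Omega\to[-\infty,\infty]$ let $\mathbb E^*U=\inf\{\mathbb E V: V\ge U,\ V \text{ measurable},\ \mathbb E V\text{ exists}\}$, and let $\mathbb P^*(A)=\mathbb E^*\mathbf 1_A$. For arbitrary maps $Z_n:\Omega\to E$ into a topological space and a Borel measurable $E$-valued random element $L$ (possibly on another probability space), $Z_n\rightsquigarrow L$ means $\mathbb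 E^*\varphi(Z_n)\to\mathbb E\varphi(L)$ for all bounded continuous $\varphi:E\to\mathbb R$ (weak convergence in the Hoffmann–Jørgensen sense). For real maps, $U_n=o_{\mathbb P^*}(1)$ means $\mathbb P^*(|U_n|>\eta)\to0$ for every $\eta>0$. **Theorem (Weak limit of the optimal value).** Suppose that $f$ is bounded, that for all sufficiently large $n$ the function $\hat f_n$ is almost surely bounded, and that, for a deterministic real sequence $\tau_n\to\infty$ and a Borel measurable $\ell^\infty(X)$-valued random element $G$, $$\tau_n(\hat f_n-f)\rightsquigarrow G\quad\text{in }\ell^\infty(X)$$ (on the exceptional null sets $\tau_n(\hat f_n-f)$ is given an arbitrary value in $\ell^\infty(X)$). Then $\iota$ is Hadamard directionally differentiable at $f$, with directional derivative $$\iota_f'(g)=\lim_{\varepsilon\downarrow0}\ \inf_{x\in S^\varepsilon} g(x),\qquad g\in\ell^\infty(X),$$ where the limit exists for every $g$; that is, $t^{-1}(\iota(f+tk)-\iota(f))\to\iota_f'(g)$ as $t\downarrow0$ and $k\to g$ in $\ell^\infty(X)$. The map $\iota_f'(G)$ is Borel measurable, $$\tau_n(\hat\psi_n-\psi^*)\ \rightsquigarrow\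 \iota_f'(G)=\lim_{\varepsilon\downarrow0}\ \inf_{x\in S^\varepsilon}G(x),$$ and $$\tau_n(\hat\psi_n-\psi^*)-\iota_f'\bigl(\tau_n(\hat f_n-f)\bigr)=o_{\mathbb P^*}(1).$$ -/

import Mathlib

open Filter Topology MeasureTheory ProbabilityTheory
open scoped ENNReal BoundedContinuousFunction

noncomputable section

/-- The outer expectation `E* U` of an arbitrary map `U` into the extended reals: the infimum of the
expectations `E V = E V⁺ - E V⁻` over the measurable majorants `V` of `U` whose expectation exists,
i.e. for which `E V⁺` and `E V⁻` are not both infinite. -/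
def outerExpectation {Ω : Type*} [MeasurableSpace Ω] (μ : Measure Ω) (U : Ω → EReal) : EReal :=
  sInf {e : EReal | ∃ V : Ω → EReal, Measurable V ∧ (∀ ω, U ω ≤ V ω) ∧
    ((∫⁻ ω, (V ω).toENNReal ∂μ) ≠ ⊤ ∨ (∫⁻ ω, (-V ω).toENNReal ∂μ) ≠ ⊤) ∧
    e = ((∫⁻ ω, (V ω).toENNReal ∂μ : ℝ≥0∞) : EReal) -
      ((∫⁻ ω, (-V ω).toENNReal ∂μ : ℝ≥0∞) : EReal)}

/-- The outer probability `P* A = E* 1_A` of an arbitrary set. -/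
def outerProbability {Ω : Type*} [MeasurableSpace Ω] (μ : Measure Ω) (A : Set Ω) : EReal :=
  outerExpectation μ (A.indicator 1)

/-- `U n = o_{P*}(1)`: the real maps `U n` converge to zero in outer probability. -/
def TendstoZeroInOuterProbability {Ω : Type*} [MeasurableSpace Ω] (μ : Measure Ω)
    (U : ℕ → Ω → ℝ) : Prop :=
  ∀ η : ℝ, 0 < η → Tendsto (fun n => outerProbability μ {ω | η < |U n ω|}) atTop (𝓝 0)

/-- Weak convergence `Z n ⇝ L` in the sense of Hoffmann-Jørgensen: the maps `Z n` are arbitrary, the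
limit `L` (possibly on another probability space) is Borel measurable, and
`E* φ(Z n) → E φ(L)` for every bounded continuous real function `φ`. -/
structure HJWeakConvergence {Ω Ω' E : Type*} [MeasurableSpace Ω] [MeasurableSpace Ω']
    [TopologicalSpace E] (μ : Measure Ω) (μ' : Measure Ω') (Z : ℕ → Ω → E) (L : Ω' → E) :
    Prop where
  borel_measurable : @Measurable Ω' E _ (borel E) L
  tendsto_outerExpectation : ∀ φ : E →ᵇ ℝ,
    Tendsto (fun n => outerExpectation μ (fun ω => ((φ (Z n ω) : ℝ) : EReal))) atTop
      (𝓝 ((∫ ω, φ (L ω) ∂μ' : ℝ) : EReal))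

/-- The Banach space `ℓ∞(X)` of bounded real functions on `X` with the supremum norm. -/
abbrev LInf (X : Type*) : Type _ := lp (fun _ : X => ℝ) ∞

open Classical in
/-- A bounded function as an element of `ℓ∞(X)`. The value `0` at unbounded functions is a
convention: it extends a map that is `ℓ∞(X)`-valued almost surely to the exceptional null set. -/
def toLInf {X : Type*} (g : X → ℝ) : LInf X :=
  if hg : Memℓp g ∞ then ⟨g, hg⟩ else 0

/-- The infimum functional on `ℓ∞(X)`. -/
def infimum {X : Type*} (g : LInf X) : ℝ := ⨅ x, g x

/-- The set of `ε`-minimizers of `f`. -/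
def nearMinimizers {X : Type*} (f : X → ℝ) (ε : ℝ) : Set X := {x | f x ≤ (⨅ y, f y) + ε}

/-- `φ` is Hadamard directionally differentiable at `u` with directional derivative `D`:
`(φ (u + t • k) - φ u) / t → D g` as `t ↓ 0` and `k → g`, for every direction `g`. -/
def HasHadamardDirDerivAt {U V : Type*} [NormedAddCommGroup U] [NormedSpace ℝ U]
    [NormedAddCommGroup V] [NormedSpace ℝ V] (φ : U → V) (D : U → V) (u : U) : Prop :=
  ∀ g : U, Tendsto (fun p : ℝ × U => p.1⁻¹ • (φ (u + p.1 • p.2) - φ u))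
    (𝓝[>] (0 : ℝ) ×ˢ 𝓝 g) (𝓝 (D g))

/-- The expected objective `f x = P h_x`. -/
def expectedObjective {X Ξ : Type*} [MeasurableSpace Ξ] (P : Measure Ξ) (h : X → Ξ → ℝ)
    (x : X) : ℝ := ∫ z, h x z ∂P

/-- The empirical objective `(1/n) ∑ h(x, ξ i)`, over the first `n` sample points
`ξ 0, …, ξ (n - 1)`. -/
def empiricalObjective {X Ξ Ω : Type*} (h : X → Ξ → ℝ) (ξ : ℕ → Ω → Ξ) (n : ℕ) (ω : Ω)
    (x : X) : ℝ := (1 / (n : ℝ)) * ∑ i ∈ Finset.range n, h x (ξ i ω)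

end

/-! Write `q t g` for the difference quotient of the infimum at `f` with step `t` in direction `g`.
The infimum is concave, so `q t g` increases as `t ↓ 0`, and its limit is `D g`, the limit of infima
over near-minimizers. With `Z n` the rescaled error of the objective, the rescaled error of the
optimal value is almost surely exactly `q (τ n)⁻¹ (Z n)` for large `n`. So once `τ n ≥ m + 1` it
lies between `q (m + 1)⁻¹ (Z n)` and `D (Z n)`. Both bounds are fixed 1-Lipschitz functions of `Z
n`, so weak convergence applies to bounded continuous functions built from them. Letting `n → ∞`,
then `m → ∞` by dominated convergence under `G`, gives the weak limit and the expansion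
(`HJWeakConvergence.of_sandwich`, `tendstoZeroInOuterProbability_of_sandwich`). No separability or
tightness of `G` enters. -/

/-! ### Outer expectation -/

section OuterExpectation

variable {Ω : Type*} [MeasurableSpace Ω] {μ : Measure Ω}

/-- The outer expectation is monotone, and insensitive to null sets. -/
theorem outerExpectation_mono_ae {U U' : Ω → EReal} (hU : ∀ᵐ ω ∂μ, U ω ≤ U' ω) :
    outerExpectation μ U ≤ outerExpectation μ U' := by
  classical
  refine le_sInf ?_
  rintro e ⟨V, hV, hUV, hfin, rfl⟩
  obtain ⟨N, hsub, hN, hN0⟩ := exists_measurable_superset_of_null (ae_iff.mp hU)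
  -- Raising `V` to `⊤` on a measurable null set gives a majorant of `U` everywhere, with the same
  -- integrals.
  let W : Ω → EReal := N.piecewise (fun _ => ⊤) V
  have hWV : W =ᵐ[μ] V := by
    filter_upwards [measure_eq_zero_iff_ae_notMem.mp hN0] with ω hω
    exact Set.piecewise_eq_of_notMem _ _ _ hω
  have hpos : ∫⁻ ω, (W ω).toENNReal ∂μ = ∫⁻ ω, (V ω).toENNReal ∂μ :=
    lintegral_congr_ae (hWV.mono fun ω hω => by simp only [hω])
  have hneg : ∫⁻ ω, (-W ω).toENNReal ∂μ = ∫⁻ ω, (-V ω).toENNReal ∂μ :=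
    lintegral_congr_ae (hWV.mono fun ω hω => by simp only [hω])
  refine sInf_le ⟨W, Measurable.piecewise hN measurable_const hV, fun ω => ?_, ?_, ?_⟩
  · by_cases hω : ω ∈ N
    · simp [W, hω]
    · have h1 : U ω ≤ U' ω := by
        by_contra hc
        exact hω (hsub hc)
      simpa [W, hω] using h1.trans (hUV ω)
  · rwa [hpos, hneg]
  · rw [hpos, hneg]

theorem outerExpectation_nonneg {U : Ω → EReal} (hU : ∀ ω, 0 ≤ U ω) :
    0 ≤ outerExpectation μ U := by
  refine le_sInf ?_
  rintro e ⟨V, -, hUV, -, rfl⟩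
  have hneg : ∫⁻ ω, (-V ω).toENNReal ∂μ = 0 := by
    have hz : ∀ ω, (-V ω).toENNReal = 0 := fun ω =>
      EReal.toENNReal_of_nonpos (by simpa using EReal.neg_le_neg_iff.mpr ((hU ω).trans (hUV ω)))
    simp [hz]
  rw [hneg]
  simp [EReal.coe_ennreal_nonneg]

end OuterExpectation

/-! ### A sandwich principle for weak convergence -/

section Sandwich

variable {Ω Ω' E : Type*} [MeasurableSpace Ω] [MeasurableSpace Ω'] [TopologicalSpace E]
  {μ : Measure Ω} {μ' : Measure Ω'} {Z : ℕ → Ω → E} {L : Ω' → E}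

/-- The largest value of `φ` on the segment between `a` and `b`. -/
noncomputable def segmentSup (φ : ℝ →ᵇ ℝ) (a b : ℝ) : ℝ :=
  sSup ((fun s : ℝ => φ (a + s * (b - a))) '' Set.Icc 0 1)

theorem bddAbove_segment (φ : ℝ →ᵇ ℝ) (a b : ℝ) :
    BddAbove ((fun s : ℝ => φ (a + s * (b - a))) '' Set.Icc 0 1) := by
  refine ⟨‖φ‖, ?_⟩
  rintro _ ⟨s, -, rfl⟩
  exact (le_abs_self _).trans (φ.norm_coe_le_norm _)

theorem abs_segmentSup_le (φ : ℝ →ᵇ ℝ) (a b : ℝ) : |segmentSup φ a b| ≤ ‖φ‖ := by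
  rw [abs_le]
  constructor
  · refine le_trans (neg_le_of_abs_le (φ.norm_coe_le_norm a)) ?_
    exact le_csSup (bddAbove_segment φ a b) ⟨0, by simp, by simp⟩
  · refine csSup_le ⟨_, 0, by simp, rfl⟩ ?_
    rintro _ ⟨s, -, rfl⟩
    exact (le_abs_self _).trans (φ.norm_coe_le_norm _)

/-- Bounds `φ (U n)` through the two ends of the sandwich alone, without monotonicity of `φ`. -/
theorem le_segmentSup (φ : ℝ →ᵇ ℝ) {a b u : ℝ} (hau : a ≤ u) (hub : u ≤ b) :
    φ u ≤ segmentSup φ a b := by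
  refine le_csSup (bddAbove_segment φ a b) ?_
  rcases (hau.trans hub).eq_or_lt with rfl | hab
  · exact ⟨0, by simp, by simp [le_antisymm hau hub]⟩
  · have hpos : 0 < b - a := sub_pos.mpr hab
    refine ⟨(u - a) / (b - a), ⟨div_nonneg (by linarith) hpos.le,
      (div_le_one hpos).mpr (by linarith)⟩, ?_⟩
    simp only [div_mul_cancel₀ _ hpos.ne']
    congr 1
    ring

theorem segmentSup_self (φ : ℝ →ᵇ ℝ) (a : ℝ) : segmentSup φ a a = φ a := by
  have hne : (Set.Icc (0 : ℝ) 1).Nonempty := ⟨0, by simp⟩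
  simp [segmentSup, hne.image_const]

/-- Parametrizing every segment by the same compact `[0, 1]` makes the supremum jointly continuous
in the endpoints. -/
theorem continuous_segmentSup (φ : ℝ →ᵇ ℝ) :
    Continuous fun p : ℝ × ℝ => segmentSup φ p.1 p.2 := by
  refine isCompact_Icc.continuous_sSup
    (f := fun (p : ℝ × ℝ) (s : ℝ) => φ (p.1 + s * (p.2 - p.1))) ?_
  exact φ.continuous.comp (by fun_prop)

/-- Bounded continuous functions converging pointwise have convergent expectations under a
Borel measurable random element. -/
theorem tendsto_integral_boundedContinuous [IsFiniteMeasure μ'] (hL : @Measurable Ω' E _ (borel E) L)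
    {Φ : ℕ → E →ᵇ ℝ} {ψ : E → ℝ} {C : ℝ} (hC : ∀ m g, |Φ m g| ≤ C)
    (hlim : ∀ g, Tendsto (fun m => Φ m g) atTop (𝓝 (ψ g))) :
    Tendsto (fun m => ∫ ω, Φ m (L ω) ∂μ') atTop (𝓝 (∫ ω, ψ (L ω) ∂μ')) := by
  borelize E
  refine tendsto_integral_of_dominated_convergence (fun _ => C) (fun m => ?_)
    (integrable_const C) (fun m => ae_of_all _ fun ω => hC m (L ω))
    (ae_of_all _ fun ω => hlim (L ω))
  exact ((Φ m).continuous.measurable.comp hL).aestronglyMeasurable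

variable {U : ℕ → Ω → ℝ} {D : E → ℝ} {q : ℕ → E → ℝ}

/-- The upper half of the sandwich principle: the outer expectations of `φ (U n)` are eventually
below every number above the expectation of `φ (D L)`. -/
theorem eventually_outerExpectation_lt_of_sandwich [IsFiniteMeasure μ']
    (hZ : HJWeakConvergence μ μ' Z L) (hD : Continuous D) (hq : ∀ m, Continuous (q m))
    (hqD : ∀ g, Tendsto (fun m => q m g) atTop (𝓝 (D g)))
    (hU : ∀ m, ∀ᶠ n in atTop, ∀ᵐ ω ∂μ, q m (Z n ω) ≤ U n ω ∧ U n ω ≤ D (Z n ω))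
    (φ : ℝ →ᵇ ℝ) {c : EReal} (hc : ((∫ ω, φ (D (L ω)) ∂μ' : ℝ) : EReal) < c) :
    ∀ᶠ n in atTop, outerExpectation μ (fun ω => ((φ (U n ω) : ℝ) : EReal)) < c := by
  let Φ : ℕ → E →ᵇ ℝ := fun m => BoundedContinuousFunction.ofNormedAddCommGroup
    (fun g => segmentSup φ (q m g) (D g))
    ((continuous_segmentSup φ).comp ((hq m).prodMk hD)) ‖φ‖ (fun g => abs_segmentSup_le φ _ _)
  have hlim := tendsto_integral_boundedContinuous (μ' := μ') hZ.borel_measurable (Φ := Φ)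
    (ψ := fun g => φ (D g)) (fun m g => abs_segmentSup_le φ (q m g) (D g)) fun g => by
      have h := ((continuous_segmentSup φ).tendsto (D g, D g)).comp
        ((hqD g).prodMk_nhds tendsto_const_nhds)
      rw [segmentSup_self] at h
      exact h
  -- The index `m` is chosen from the limit law alone; only then does `n` go to infinity.
  obtain ⟨m, hm⟩ :=
    (((continuous_coe_real_ereal.tendsto _).comp hlim).eventually_lt_const hc).exists
  filter_upwards [(hZ.tendsto_outerExpectation (Φ m)).eventually_lt_const hm, hU m] with n hn hUn
  refine lt_of_le_of_lt (outerExpectation_mono_ae ?_) hn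
  filter_upwards [hUn] with ω hω
  exact EReal.coe_le_coe_iff.mpr (le_segmentSup φ hω.1 hω.2)

/-- The lower half of the sandwich principle. -/
theorem eventually_lt_outerExpectation_of_sandwich [IsFiniteMeasure μ']
    (hZ : HJWeakConvergence μ μ' Z L) (hD : Continuous D) (hq : ∀ m, Continuous (q m))
    (hqD : ∀ g, Tendsto (fun m => q m g) atTop (𝓝 (D g)))
    (hU : ∀ m, ∀ᶠ n in atTop, ∀ᵐ ω ∂μ, q m (Z n ω) ≤ U n ω ∧ U n ω ≤ D (Z n ω))
    (φ : ℝ →ᵇ ℝ) {c : EReal} (hc : c < ((∫ ω, φ (D (L ω)) ∂μ' : ℝ) : EReal)) :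
    ∀ᶠ n in atTop, c < outerExpectation μ (fun ω => ((φ (U n ω) : ℝ) : EReal)) := by
  -- `-segmentSup (-φ)` is the least value of `φ` on the segment.
  let Φ : ℕ → E →ᵇ ℝ := fun m => BoundedContinuousFunction.ofNormedAddCommGroup
    (fun g => -segmentSup (-φ) (q m g) (D g))
    ((continuous_segmentSup (-φ)).comp ((hq m).prodMk hD)).neg ‖-φ‖
    (fun g => by simpa using abs_segmentSup_le (-φ) (q m g) (D g))
  have hlim := tendsto_integral_boundedContinuous (μ' := μ') hZ.borel_measurable (Φ := Φ)
    (ψ := fun g => φ (D g)) (C := ‖-φ‖) (fun m g => by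
      simpa [Φ] using abs_segmentSup_le (-φ) (q m g) (D g)) fun g => by
      have h := (((continuous_segmentSup (-φ)).tendsto (D g, D g)).comp
        ((hqD g).prodMk_nhds tendsto_const_nhds)).neg
      simp only [segmentSup_self, BoundedContinuousFunction.coe_neg, Pi.neg_apply, neg_neg] at h
      exact h
  obtain ⟨m, hm⟩ :=
    (((continuous_coe_real_ereal.tendsto _).comp hlim).eventually_const_lt hc).exists
  filter_upwards [(hZ.tendsto_outerExpectation (Φ m)).eventually_const_lt hm, hU m] with n hn hUn
  refine lt_of_lt_of_le hn (outerExpectation_mono_ae ?_)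
  filter_upwards [hUn] with ω hω
  have h := le_segmentSup (-φ) hω.1 hω.2
  simp only [BoundedContinuousFunction.coe_neg, Pi.neg_apply] at h
  exact EReal.coe_le_coe_iff.mpr (show -segmentSup (-φ) (q m (Z n ω)) (D (Z n ω)) ≤ _ by linarith)

/-- If the maps `U n` lie between `q m (Z n)` and `D (Z n)` for all large `n`, where `q m → D`
pointwise, then `U n` inherits the weak limit of `D (Z n)`. -/
theorem HJWeakConvergence.of_sandwich [IsFiniteMeasure μ']
    (hZ : HJWeakConvergence μ μ' Z L) (hD : Continuous D) (hq : ∀ m, Continuous (q m))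
    (hqD : ∀ g, Tendsto (fun m => q m g) atTop (𝓝 (D g)))
    (hU : ∀ m, ∀ᶠ n in atTop, ∀ᵐ ω ∂μ, q m (Z n ω) ≤ U n ω ∧ U n ω ≤ D (Z n ω)) :
    HJWeakConvergence μ μ' U (fun ω => D (L ω)) where
  borel_measurable := by
    borelize E
    rw [← BorelSpace.measurable_eq (α := ℝ)]
    exact hD.measurable.comp hZ.borel_measurable
  tendsto_outerExpectation φ := tendsto_order.mpr
    ⟨fun _ hc => eventually_lt_outerExpectation_of_sandwich hZ hD hq hqD hU φ hc,
      fun _ hc => eventually_outerExpectation_lt_of_sandwich hZ hD hq hqD hU φ hc⟩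

/-- Under the sandwich condition, `U n` and `D (Z n)` are asymptotically equivalent. -/
theorem tendstoZeroInOuterProbability_of_sandwich [IsFiniteMeasure μ']
    (hZ : HJWeakConvergence μ μ' Z L) (hD : Continuous D) (hq : ∀ m, Continuous (q m))
    (hqD : ∀ g, Tendsto (fun m => q m g) atTop (𝓝 (D g)))
    (hU : ∀ m, ∀ᶠ n in atTop, ∀ᵐ ω ∂μ, q m (Z n ω) ≤ U n ω ∧ U n ω ≤ D (Z n ω)) :
    TendstoZeroInOuterProbability μ (fun n ω => U n ω - D (Z n ω)) := by
  intro η hη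
  have hnonneg : ∀ n, 0 ≤ outerProbability μ {ω | η < |U n ω - D (Z n ω)|} := fun n =>
    outerExpectation_nonneg fun ω => Set.indicator_nonneg (fun _ _ => zero_le_one) ω
  have hbound : ∀ m g, |min (|D g - q m g| / η) 1| ≤ 1 := fun m g => by
    rw [abs_of_nonneg (by positivity)]
    exact min_le_right _ _
  -- A truncated Markov bound: the sandwich gives `|U n - D (Z n)| ≤ D (Z n) - q m (Z n)`, so this
  -- continuous function of `Z n` dominates the indicator.
  let Φ : ℕ → E →ᵇ ℝ := fun m => BoundedContinuousFunction.ofNormedAddCommGroup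
    (fun g => min (|D g - q m g| / η) 1)
    (((hD.sub (hq m)).abs.div_const η).min continuous_const) 1 (hbound m)
  have hlim := tendsto_integral_boundedContinuous (μ' := μ') hZ.borel_measurable (Φ := Φ)
    (ψ := fun _ => 0) hbound fun g => by
      have h : Tendsto (fun m => min (|D g - q m g| / η) 1) atTop
          (𝓝 (min (|D g - D g| / η) 1)) :=
        ((tendsto_const_nhds.sub (hqD g)).abs.div_const η).min tendsto_const_nhds
      rw [sub_self, abs_zero, zero_div, min_eq_left zero_le_one] at h
      exact h
  rw [integral_zero] at hlim
  refine tendsto_order.mpr ⟨fun c hc => Eventually.of_forall fun n => hc.trans_le (hnonneg n),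
    fun c hc => ?_⟩
  obtain ⟨m, hm⟩ := (((continuous_coe_real_ereal.tendsto _).comp hlim).eventually_lt_const
    (by simpa using hc)).exists
  filter_upwards [(hZ.tendsto_outerExpectation (Φ m)).eventually_lt_const hm, hU m] with n hn hUn
  refine lt_of_le_of_lt (outerExpectation_mono_ae ?_) hn
  filter_upwards [hUn] with ω hω
  by_cases hmem : η < |U n ω - D (Z n ω)|
  · rw [Set.indicator_of_mem (by exact hmem), Pi.one_apply, ← EReal.coe_one,
      EReal.coe_le_coe_iff]
    refine le_min ((one_le_div hη).mpr (hmem.le.trans ?_)) le_rfl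
    rw [abs_sub_comm, abs_of_nonneg (sub_nonneg.mpr hω.2)]
    exact (sub_le_sub_left hω.1 _).trans (le_abs_self _)
  · rw [Set.indicator_of_notMem (by exact hmem), ← EReal.coe_zero, EReal.coe_le_coe_iff]
    exact le_min (by positivity) zero_le_one

end Sandwich

/-! ### The directional derivative of the infimum -/

section Infimum

variable {X : Type*}

theorem LInf.abs_apply_le (g : LInf X) (x : X) : |g x| ≤ ‖g‖ :=
  lp.norm_apply_le_norm ENNReal.top_ne_zero g x

theorem LInf.bddBelow_range_comp {ι : Type*} (g : LInf X) (e : ι → X) :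
    BddBelow (Set.range fun i => g (e i)) := by
  refine ⟨-‖g‖, ?_⟩
  rintro _ ⟨i, rfl⟩
  exact neg_le_of_abs_le (g.abs_apply_le (e i))

/-- The map `e` covers both infima over `X` and infima over near-minimizers. -/
theorem LInf.iInf_comp_le_add_norm_sub {ι : Type*} [Nonempty ι] (g k : LInf X) (e : ι → X) :
    (⨅ i, g (e i)) ≤ (⨅ i, k (e i)) + ‖g - k‖ := by
  rw [← sub_le_iff_le_add]
  refine le_ciInf fun i => ?_
  have h1 := ciInf_le (g.bddBelow_range_comp e) i
  have h2 := le_of_abs_le ((g - k).abs_apply_le (e i))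
  have h3 : (g - k) (e i) = g (e i) - k (e i) := rfl
  linarith

theorem infimum_le (g : LInf X) (x : X) : infimum g ≤ g x :=
  ciInf_le (g.bddBelow_range_comp id) x

theorem infimum_le_add_norm_sub [Nonempty X] (g k : LInf X) :
    infimum g ≤ infimum k + ‖g - k‖ :=
  LInf.iInf_comp_le_add_norm_sub g k id

theorem continuous_of_le_add_norm_sub {E : Type*} [SeminormedAddCommGroup E] {F : E → ℝ}
    (hF : ∀ g k, F g ≤ F k + ‖g - k‖) : Continuous F := by
  refine (LipschitzWith.of_le_add_mul 1 fun g k => ?_).continuous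
  simpa [dist_eq_norm] using hF g k

theorem nearMinimizers_nonempty [Nonempty X] (f : LInf X) {ε : ℝ} (hε : 0 < ε) :
    (nearMinimizers f ε).Nonempty := by
  obtain ⟨x, hx⟩ := exists_lt_of_ciInf_lt (show (⨅ y, f y) < (⨅ y, f y) + ε by linarith)
  exact ⟨x, hx.le⟩

theorem nearMinimizers_mono (f : X → ℝ) {ε δ : ℝ} (h : ε ≤ δ) :
    nearMinimizers f ε ⊆ nearMinimizers f δ :=
  fun _ hx => le_trans (α := ℝ) hx (by linarith)

/-- The infimum of `g` over the `ε`-minimizers of `f`. -/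
noncomputable def nearInfimum (f g : LInf X) (ε : ℝ) : ℝ := ⨅ x : nearMinimizers f ε, g x

/-- The directional derivative of the infimum functional at `f` in direction `g`. -/
noncomputable def infimumDeriv (f g : LInf X) : ℝ := sSup (nearInfimum f g '' Set.Ioi 0)

/-- The difference quotient of the infimum functional at `f` in direction `g`. -/
noncomputable def infimumQuotient (f : LInf X) (t : ℝ) (g : LInf X) : ℝ :=
  t⁻¹ * (infimum (f + t • g) - infimum f)

/-- The rescaled difference of infima is a difference quotient in the rescaled difference of the
functions. -/
theorem mul_iInf_sub_iInf_eq_infimumQuotient (f : LInf X) {u : X → ℝ} (hu : Memℓp u ∞) {τ : ℝ}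
    (hτ : 0 < τ) :
    τ * ((⨅ x, u x) - ⨅ x, f x) =
      infimumQuotient f τ⁻¹ (toLInf fun x => τ * (u x - f x)) := by
  have hmem : Memℓp (fun x => τ * (u x - f x)) ∞ := (hu.sub f.2).const_mul τ
  have hval : ∀ x, (f + τ⁻¹ • toLInf fun x => τ * (u x - f x)) x = u x := by
    intro x
    -- Boundedness of `u` rules out the default value `0`.
    rw [toLInf, dif_pos hmem]
    change f x + τ⁻¹ * (τ * (u x - f x)) = u x
    rw [inv_mul_cancel_left₀ hτ.ne', add_sub_cancel]
  rw [infimumQuotient, inv_inv, infimum, infimum]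
  simp only [hval]

variable [Nonempty X]

theorem nearInfimum_le_norm (f g : LInf X) {ε : ℝ} (hε : 0 < ε) : nearInfimum f g ε ≤ ‖g‖ := by
  obtain ⟨x, hx⟩ := nearMinimizers_nonempty f hε
  exact (ciInf_le (g.bddBelow_range_comp Subtype.val) ⟨x, hx⟩).trans
    (le_of_abs_le (g.abs_apply_le x))

theorem nearInfimum_antitoneOn (f g : LInf X) : AntitoneOn (nearInfimum f g) (Set.Ioi 0) := by
  intro ε hε δ _ h
  have : Nonempty (nearMinimizers f ε) := (nearMinimizers_nonempty f hε).to_subtype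
  exact le_ciInf fun x => ciInf_le (g.bddBelow_range_comp Subtype.val)
    (⟨x, nearMinimizers_mono f h x.2⟩ : nearMinimizers f δ)

theorem bddAbove_nearInfimum (f g : LInf X) : BddAbove (nearInfimum f g '' Set.Ioi 0) := by
  refine ⟨‖g‖, ?_⟩
  rintro _ ⟨ε, hε, rfl⟩
  exact nearInfimum_le_norm f g hε

theorem nearInfimum_le_infimumDeriv (f g : LInf X) {ε : ℝ} (hε : 0 < ε) :
    nearInfimum f g ε ≤ infimumDeriv f g :=
  le_csSup (bddAbove_nearInfimum f g) ⟨ε, hε, rfl⟩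

/-- Shrinking `ε` shrinks the set of near-minimizers and raises the infimum, so the supremum over
`ε` is the limit. -/
theorem tendsto_nearInfimum (f g : LInf X) :
    Tendsto (nearInfimum f g) (𝓝[>] 0) (𝓝 (infimumDeriv f g)) :=
  (nearInfimum_antitoneOn f g).tendsto_nhdsGT (bddAbove_nearInfimum f g)

theorem continuous_infimumDeriv (f : LInf X) : Continuous (infimumDeriv f) := by
  refine continuous_of_le_add_norm_sub fun g k => csSup_le (Set.nonempty_Ioi.image _) ?_
  rintro _ ⟨ε, hε, rfl⟩
  have : Nonempty (nearMinimizers f ε) := (nearMinimizers_nonempty f hε).to_subtype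
  have h1 : nearInfimum f g ε ≤ nearInfimum f k ε + ‖g - k‖ :=
    LInf.iInf_comp_le_add_norm_sub g k Subtype.val
  have h2 := nearInfimum_le_infimumDeriv f k hε
  linarith

theorem infimumQuotient_le_add_norm_sub (f : LInf X) {t : ℝ} (ht : 0 < t) (g k : LInf X) :
    infimumQuotient f t g ≤ infimumQuotient f t k + ‖g - k‖ := by
  have h := infimum_le_add_norm_sub (f + t • g) (f + t • k)
  rw [add_sub_add_left_eq_sub, ← smul_sub, norm_smul, Real.norm_of_nonneg ht.le] at h
  calc infimumQuotient f t g
      ≤ t⁻¹ * (infimum (f + t • k) - infimum f + t * ‖g - k‖) :=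
        mul_le_mul_of_nonneg_left (by linarith) (inv_nonneg.mpr ht.le)
    _ = infimumQuotient f t k + ‖g - k‖ := by
        rw [mul_add, inv_mul_cancel_left₀ ht.ne', infimumQuotient]

theorem continuous_infimumQuotient (f : LInf X) {t : ℝ} (ht : 0 < t) :
    Continuous (infimumQuotient f t) :=
  continuous_of_le_add_norm_sub (infimumQuotient_le_add_norm_sub f ht)

theorem le_infimumQuotient_iff (f g : LInf X) {t : ℝ} (ht : 0 < t) {c : ℝ} :
    c ≤ infimumQuotient f t g ↔ ∀ x, infimum f + t * c ≤ f x + t * g x := by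
  rw [infimumQuotient, le_inv_mul_iff₀ ht, le_sub_iff_add_le']
  exact le_ciInf_iff ((f + t • g).bddBelow_range_comp id)

/-- By concavity of the infimum, its difference quotients decrease in the step size. -/
theorem infimumQuotient_antitone (f g : LInf X) {s t : ℝ} (hs : 0 < s) (hst : s ≤ t) :
    infimumQuotient f t g ≤ infimumQuotient f s g := by
  have ht := hs.trans_le hst
  rw [le_infimumQuotient_iff f g hs]
  intro x
  have h1 := (le_infimumQuotient_iff f g ht).mp le_rfl x
  have h2 := infimum_le f x
  refine le_of_mul_le_mul_left ?_ ht
  -- This is `t (f + s g) = s (f + t g) + (t - s) f`, with each summand bounded below.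
  nlinarith [mul_le_mul_of_nonneg_left h1 hs.le,
    mul_le_mul_of_nonneg_left h2 (sub_nonneg.mpr hst)]

theorem infimumQuotient_le_infimumDeriv (f g : LInf X) {t : ℝ} (ht : 0 < t) :
    infimumQuotient f t g ≤ infimumDeriv f g := by
  refine le_of_forall_pos_le_add fun η hη => ?_
  -- The excess of `f` costs `η / 2` after division by `t`; near-minimality of `g x` costs the other
  -- half.
  have hε : 0 < t * (η / 2) := by positivity
  have : Nonempty (nearMinimizers f (t * (η / 2))) := (nearMinimizers_nonempty f hε).to_subtype
  obtain ⟨⟨x, hx⟩, hgx⟩ := exists_lt_of_ciInf_lt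
    (show (⨅ x : nearMinimizers f (t * (η / 2)), g x) < infimumDeriv f g + η / 2 by
      have := nearInfimum_le_infimumDeriv f g hε
      rw [nearInfimum] at this
      linarith)
  have h1 := (le_infimumQuotient_iff f g ht).mp le_rfl x
  have h2 : f x ≤ infimum f + t * (η / 2) := hx
  have h3 := mul_le_mul_of_nonneg_left hgx.le ht.le
  refine le_of_mul_le_mul_left ?_ ht
  linarith

theorem nearInfimum_le_infimumQuotient (f g : LInf X) {t : ℝ} (ht : 0 < t) :
    nearInfimum f g (t * (2 * (‖g‖ + 1))) ≤ infimumQuotient f t g := by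
  -- Perturbing by `t • g` moves values by at most `t * ‖g‖`, and the bound to be beaten exceeds
  -- `infimum f` by at most `t * ‖g‖`. Points of larger excess are thus harmless; the `+ 1` keeps
  -- the tolerance positive when `g = 0`.
  have hε : 0 < t * (2 * (‖g‖ + 1)) := by positivity
  rw [le_infimumQuotient_iff f g ht]
  intro x
  have h1 := nearInfimum_le_norm f g hε
  by_cases hx : x ∈ nearMinimizers f (t * (2 * (‖g‖ + 1)))
  · have h2 : nearInfimum f g _ ≤ g x :=
      ciInf_le (g.bddBelow_range_comp Subtype.val) (⟨x, hx⟩ : nearMinimizers f _)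
    exact add_le_add (infimum_le f x) (mul_le_mul_of_nonneg_left h2 ht.le)
  · have h2 : infimum f + t * (2 * (‖g‖ + 1)) < f x := not_le.mp hx
    have h3 := mul_le_mul_of_nonneg_left h1 ht.le
    have h4 := mul_le_mul_of_nonneg_left (neg_le_of_abs_le (g.abs_apply_le x)) ht.le
    linarith

theorem tendsto_infimumQuotient (f g : LInf X) :
    Tendsto (fun t => infimumQuotient f t g) (𝓝[>] 0) (𝓝 (infimumDeriv f g)) := by
  have hscale : Tendsto (fun t : ℝ => t * (2 * (‖g‖ + 1))) (𝓝[>] 0) (𝓝[>] 0) := by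
    refine tendsto_nhdsWithin_iff.mpr ⟨?_, ?_⟩
    · have h : Continuous fun t : ℝ => t * (2 * (‖g‖ + 1)) := by fun_prop
      simpa using (h.tendsto 0).mono_left nhdsWithin_le_nhds
    · filter_upwards [self_mem_nhdsWithin] with t ht
      exact Set.mem_Ioi.mpr (mul_pos (Set.mem_Ioi.mp ht) (by positivity))
  refine tendsto_of_tendsto_of_tendsto_of_le_of_le' ((tendsto_nearInfimum f g).comp hscale)
    tendsto_const_nhds ?_ ?_
  · filter_upwards [self_mem_nhdsWithin] with t ht using nearInfimum_le_infimumQuotient f g ht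
  · filter_upwards [self_mem_nhdsWithin] with t ht using infimumQuotient_le_infimumDeriv f g ht

/-- The quotients are 1-Lipschitz in the direction uniformly in the step, which upgrades the limit
along fixed `g` to one along `k → g`. -/
theorem hasHadamardDirDerivAt_infimum (f : LInf X) :
    HasHadamardDirDerivAt infimum (infimumDeriv f) f := by
  intro g
  have hfst : Tendsto (fun p : ℝ × LInf X => infimumQuotient f p.1 g)
      (𝓝[>] (0 : ℝ) ×ˢ 𝓝 g) (𝓝 (infimumDeriv f g)) :=
    (tendsto_infimumQuotient f g).comp tendsto_fst
  have hsnd : Tendsto (fun p : ℝ × LInf X => ‖p.2 - g‖) (𝓝[>] (0 : ℝ) ×ˢ 𝓝 g) (𝓝 0) :=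
    (tendsto_iff_norm_sub_tendsto_zero.mp tendsto_id).comp tendsto_snd
  have hpos : ∀ᶠ p : ℝ × LInf X in 𝓝[>] (0 : ℝ) ×ˢ 𝓝 g, 0 < p.1 :=
    tendsto_fst.eventually self_mem_nhdsWithin
  refine tendsto_of_tendsto_of_tendsto_of_le_of_le' (by simpa using hfst.sub hsnd)
    (by simpa using hfst.add hsnd) ?_ ?_
  · filter_upwards [hpos] with p hp
    have h := infimumQuotient_le_add_norm_sub f hp g p.2
    rw [norm_sub_rev] at h
    exact sub_le_iff_le_add.mpr h
  · filter_upwards [hpos] with p hp using infimumQuotient_le_add_norm_sub f hp p.2 g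

end Infimum

theorem mainTheorem2 {X Ξ Ω Ω' : Type*} [Nonempty X]
    [MeasurableSpace Ξ] [MeasurableSpace Ω] [MeasurableSpace Ω']
    (P : Measure Ξ) [IsProbabilityMeasure P]
    (μ : Measure Ω) [IsProbabilityMeasure μ]
    (μ' : Measure Ω') [IsProbabilityMeasure μ']
    -- the loss and the i.i.d. sample with law `P`
    (h : X → Ξ → ℝ) (h_meas : ∀ x, Measurable (h x)) (h_int : ∀ x, Integrable (h x) P)
    (ξ : ℕ → Ω → Ξ) (ξ_meas : ∀ i, Measurable (ξ i)) (ξ_indep : iIndepFun ξ μ)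
    (ξ_law : ∀ i, μ.map (ξ i) = P)
    -- boundedness of the objectives
    (hf : Memℓp (expectedObjective P h) ∞)
    (hfn : ∀ᶠ n in atTop, ∀ᵐ ω ∂μ, Memℓp (empiricalObjective h ξ n ω) ∞)
    -- weak convergence of the rescaled objectives
    (τ : ℕ → ℝ) (hτ : Tendsto τ atTop atTop)
    (G : Ω' → LInf X)
    (hG : HJWeakConvergence μ μ'
      (fun n ω => toLInf fun x =>
        τ n * (empiricalObjective h ξ n ω x - expectedObjective P h x)) G) :
    ∃ D : LInf X → ℝ,
      -- `D` is the directional derivative of the infimum map at `f`, given by the limit formula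
      HasHadamardDirDerivAt infimum D (⟨expectedObjective P h, hf⟩ : LInf X) ∧
      (∀ g : LInf X,
        Tendsto (fun ε : ℝ => ⨅ x : nearMinimizers (expectedObjective P h) ε, g x)
          (𝓝[>] 0) (𝓝 (D g))) ∧
      -- weak limit of the optimal values
      HJWeakConvergence μ μ'
        (fun n ω => τ n * ((⨅ x, empiricalObjective h ξ n ω x) - ⨅ x, expectedObjective P h x))
        (fun ω' => D (G ω')) ∧
      -- first-order expansion
      TendstoZeroInOuterProbability μ
        (fun n ω => τ n * ((⨅ x, empiricalObjective h ξ n ω x) - ⨅ x, expectedObjective P h x) -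
          D (toLInf fun x =>
            τ n * (empiricalObjective h ξ n ω x - expectedObjective P h x))) := by
  let f : LInf X := ⟨expectedObjective P h, hf⟩
  have hstep : ∀ m : ℕ, 0 < ((m : ℝ) + 1)⁻¹ := fun m => by positivity
  have hstep_lim : Tendsto (fun m : ℕ => ((m : ℝ) + 1)⁻¹) atTop (𝓝[>] 0) :=
    tendsto_nhdsWithin_iff.mpr ⟨by simpa using tendsto_one_div_add_atTop_nhds_zero_nat (𝕜 := ℝ),
      Eventually.of_forall hstep⟩
  have hq : ∀ m : ℕ, Continuous (infimumQuotient f ((m : ℝ) + 1)⁻¹) := fun m =>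
    continuous_infimumQuotient f (hstep m)
  have hqD : ∀ g, Tendsto (fun m : ℕ => infimumQuotient f ((m : ℝ) + 1)⁻¹ g) atTop
      (𝓝 (infimumDeriv f g)) := fun g => (tendsto_infimumQuotient f g).comp hstep_lim
  have hU : ∀ m : ℕ, ∀ᶠ n in atTop, ∀ᵐ ω ∂μ,
      infimumQuotient f ((m : ℝ) + 1)⁻¹ (toLInf fun x =>
          τ n * (empiricalObjective h ξ n ω x - expectedObjective P h x)) ≤
        τ n * ((⨅ x, empiricalObjective h ξ n ω x) - ⨅ x, expectedObjective P h x) ∧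
      τ n * ((⨅ x, empiricalObjective h ξ n ω x) - ⨅ x, expectedObjective P h x) ≤
        infimumDeriv f (toLInf fun x =>
          τ n * (empiricalObjective h ξ n ω x - expectedObjective P h x)) := by
    intro m
    -- For these `n` the actual step `(τ n)⁻¹` is at most `(m + 1)⁻¹`, so monotonicity in the step
    -- gives the lower bound.
    filter_upwards [hfn, hτ.eventually_ge_atTop ((m : ℝ) + 1)] with n hn hτn
    have hm : 0 < (m : ℝ) + 1 := by positivity
    have hpos : 0 < τ n := hm.trans_le hτn
    filter_upwards [hn] with ω hω
    have heq := mul_iInf_sub_iInf_eq_infimumQuotient f hω hpos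
    change τ n * ((⨅ x, empiricalObjective h ξ n ω x) - ⨅ x, expectedObjective P h x) =
      infimumQuotient f (τ n)⁻¹ (toLInf fun x =>
        τ n * (empiricalObjective h ξ n ω x - expectedObjective P h x)) at heq
    rw [heq]
    exact ⟨infimumQuotient_antitone f _ (inv_pos.mpr hpos) (inv_anti₀ hm hτn),
      infimumQuotient_le_infimumDeriv f _ (inv_pos.mpr hpos)⟩
  exact ⟨infimumDeriv f, hasHadamardDirDerivAt_infimum f, tendsto_nearInfimum f,
    hG.of_sandwich (continuous_infimumDeriv f) hq hqD hU,
    tendstoZeroInOuterProbability_of_sandwich hG (continuous_infimumDeriv f) hq hqD hU⟩
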